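/- Let $\mathcal{A}$ be an abelian category with enough injectives and let $F:\mathcal{A}\to\mathbf{Ab}$ be an additive contravariant functor. For $B\in\mathcal{A}$ choose an injective container $0\to B\to I$ and let $\Sigma B$ be its cokernel; iterating gives the cosyzygies $\Sigma^{n}B$ ($\Sigma^0B=B$) and an injective resolution $0\to B\to I^0\to I^1\to\cdots$ whose differentials factor as $I^n\twoheadrightarrow\Sigma^{n+1}B\rightarrowtail I^{n+1}$. Let $L^{n}F$ be the left-derived functors, $L^nF(B)=H_n(F(I^{\bullet}))$, let $\lambda_F:L^0F\to F$ be the canonical natural transformation, and let the quot-stabilization $\underline{F}$ of $F$ be the cokernel of $\lambda_F$. It vanishes on injectives, so the $\underline{F}\circ\Sigma^n$ are well-defined functors. Let $S_0F=F$, let $S_1F$ be the first left satellite, $S_1F(B)=\operatorname{Ker}(F(\Sigma B)\to F(I^0))$, and let $S_{n+1}F=S_1F\circ\Sigma^{n}$ be the higher left satellites. The left fundamental sequence of $F$ is the sequence of functors $$\cdots\to S_{n+1}F\to\underline{F}\circ\Sigma^{n+1}\to L^{n}F\to S_nF\to\underline{F}\circ\Sigma^{n}\to\cdots\to L^1F\to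 S_1F\to\underline{F}\circ\Sigma\xrightarrow{\alpha_F}L^0F\xrightarrow{\lambda_F}F\to\underline{F}\to0 .$$ Here $F\to\underline F$ is the canonical epimorphism; for $n\ge1$ the map $L^nF(B)\to S_nF(B)\subseteq F(\Sigma^nB)$ is induced by $F(I^n)\to F(\Sigma^nB)$, and $S_nF(B)\to\underline{F}(\Sigma^nB)$ is the inclusion into $F(\Sigma^nB)$ followed by the canonical epimorphism; for $n\ge0$ the map $\underline{F}(\Sigma^{n+1}B)\to L^nF(B)$ is induced by $F(\Sigma^{n+1}B)\to F(I^n)$, and for $n=0$ it is $\alpha_F(B)$. Then: 1. The left fundamental sequence is a complex whose homology is zero except, possibly, at the terms $L^{n}F$, $n\ge0$. 2. If $F$ is half-exact (for every short exact sequence $0\to X\to Y\to Z\to0$ in $\mathcal{A}$ the sequence $F(Z)\to F(Y)\to F(X)$ is exact), then the sequence is exact. 3. If $F$ carries epimorphisms to monomorphisms, then $\alpha_F$ is monic. 4. If $F$ carries monomorphisms to epimorphisms, then $\underline{F}=0$ and $\lambda_F$ is epic. 5. $\lambda_F$ is an isomorphism if and only if $F$ is right-exact. -/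

import Mathlib

open CategoryTheory CategoryTheory.Limits Opposite

universe w v u

set_option linter.unusedSectionVars false

noncomputable section

namespace FundamentalSequence

variable {A : Type u} [Category.{v} A] [Abelian A] [EnoughInjectives A]

/-! ### Cosyzygies -/

/-- The cosyzygy `Σ B`: the cokernel of the inclusion of `B` in an injective container. -/
def cosyzygy (B : A) : A := cokernel (Injective.ι B)

/-- The canonical epimorphism `e` from the injective container of `B` to `Σ B`. -/
def toCosyzygy (B : A) : Injective.under B ⟶ cosyzygy B := cokernel.π (Injective.ι B)

instance (B : A) : Epi (toCosyzygy B) :=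
  inferInstanceAs (Epi (cokernel.π (Injective.ι B)))

lemma ι_toCosyzygy (B : A) : Injective.ι B ≫ toCosyzygy B = 0 :=
  cokernel.condition _

/-- A (chosen) extension of `f` to the injective containers. -/
def containerMap {B C : A} (f : B ⟶ C) : Injective.under B ⟶ Injective.under C :=
  Injective.factorThru (f ≫ Injective.ι C) (Injective.ι B)

lemma ι_containerMap {B C : A} (f : B ⟶ C) :
    Injective.ι B ≫ containerMap f = f ≫ Injective.ι C :=
  Injective.comp_factorThru _ _

/-- The morphism `Σ B ⟶ Σ C` induced by `containerMap f`. -/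
def cosyzygyMap {B C : A} (f : B ⟶ C) : cosyzygy B ⟶ cosyzygy C :=
  cokernel.map (Injective.ι B) (Injective.ι C) f (containerMap f) (ι_containerMap f)

lemma toCosyzygy_cosyzygyMap {B C : A} (f : B ⟶ C) :
    toCosyzygy B ≫ cosyzygyMap f = containerMap f ≫ toCosyzygy C :=
  cokernel.π_desc (Injective.ι B) _ _

/-- The iterated cosyzygy `Σⁿ B`. -/
def cosyzygyIter : ℕ → A → A
  | 0, B => B
  | n + 1, B => cosyzygy (cosyzygyIter n B)

/-- The morphism `Σⁿ B ⟶ Σⁿ C` induced by `f`, well defined up to morphisms that factor through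
injectives. -/
def cosyzygyIterMap : (n : ℕ) → {B C : A} → (B ⟶ C) → (cosyzygyIter n B ⟶ cosyzygyIter n C)
  | 0, _, _, f => f
  | n + 1, _, _, f => cosyzygyMap (cosyzygyIterMap n f)

/-- `f` factors through an injective object. -/
def FactorsThruInjective {B C : A} (f : B ⟶ C) : Prop :=
  ∃ (I : A) (_ : Injective I) (a : B ⟶ I) (b : I ⟶ C), a ≫ b = f

lemma FactorsThruInjective.zero (B C : A) : FactorsThruInjective (0 : B ⟶ C) :=
  ⟨Injective.under B, inferInstance, 0, 0, by simp⟩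

/-- If `u` extends `f` to the injective containers, and `f` factors through an injective, then
so does the map `g` that `u` induces on the cosyzygies; in fact `g` factors through `e`. -/
lemma exists_factor {B C : A} {f : B ⟶ C} (hf : FactorsThruInjective f)
    (u : Injective.under B ⟶ Injective.under C) (g : cosyzygy B ⟶ cosyzygy C)
    (hu : Injective.ι B ≫ u = f ≫ Injective.ι C)
    (hg : toCosyzygy B ≫ g = u ≫ toCosyzygy C) :
    ∃ h : cosyzygy B ⟶ Injective.under C, h ≫ toCosyzygy C = g := by
  obtain ⟨I, hI, a, b, rfl⟩ := hf
  let a' : Injective.under B ⟶ I := Injective.factorThru a (Injective.ι B)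
  have ha' : Injective.ι B ≫ a' = a := Injective.comp_factorThru _ _
  have h : Injective.ι B ≫ (u - a' ≫ b ≫ Injective.ι C) = 0 := by
    rw [Preadditive.comp_sub, hu, reassoc_of% ha', Category.assoc, sub_self]
  have h' : toCosyzygy B ≫ cokernel.desc (Injective.ι B) _ h = u - a' ≫ b ≫ Injective.ι C :=
    cokernel.π_desc (Injective.ι B) _ h
  refine ⟨cokernel.desc (Injective.ι B) _ h, (cancel_epi (toCosyzygy B)).1 ?_⟩
  rw [hg]
  refine (Category.assoc _ _ _).symm.trans ?_
  rw [h', Preadditive.sub_comp, Category.assoc, Category.assoc, ι_toCosyzygy, comp_zero,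
    comp_zero, sub_zero]

lemma cosyzygyMap_sub {B C : A} (f g : B ⟶ C) (k : cosyzygy B ⟶ cosyzygy C)
    (u : Injective.under B ⟶ Injective.under C)
    (hu : Injective.ι B ≫ u = g ≫ Injective.ι C)
    (hk : toCosyzygy B ≫ k = u ≫ toCosyzygy C)
    (hfg : FactorsThruInjective (f - g)) :
    ∃ h : cosyzygy B ⟶ Injective.under C, h ≫ toCosyzygy C = cosyzygyMap f - k :=
  exists_factor hfg (containerMap f - u) _
    (by rw [Preadditive.comp_sub, Preadditive.sub_comp, ι_containerMap, hu])
    (by rw [Preadditive.comp_sub, Preadditive.sub_comp, toCosyzygy_cosyzygyMap, hk])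

lemma cosyzygyMap_id_sub (B : A) :
    ∃ h : cosyzygy B ⟶ Injective.under B, h ≫ toCosyzygy B = cosyzygyMap (𝟙 B) - 𝟙 _ :=
  cosyzygyMap_sub (𝟙 B) (𝟙 B) (𝟙 _) (𝟙 _) (by simp) (by simp)
    (by rw [sub_self]; exact .zero _ _)

lemma cosyzygyMap_comp_sub {B C D : A} (k : B ⟶ D) (f : B ⟶ C) (g : C ⟶ D)
    (hk : FactorsThruInjective (k - f ≫ g)) :
    ∃ h : cosyzygy B ⟶ Injective.under D,
      h ≫ toCosyzygy D = cosyzygyMap k - cosyzygyMap f ≫ cosyzygyMap g :=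
  cosyzygyMap_sub k (f ≫ g) _ (containerMap f ≫ containerMap g)
    (by rw [← Category.assoc, ι_containerMap, Category.assoc, ι_containerMap, Category.assoc])
    (by rw [← Category.assoc, toCosyzygy_cosyzygyMap, Category.assoc, toCosyzygy_cosyzygyMap,
          Category.assoc]) hk

lemma FactorsThruInjective.of_factor {B C D : A} [Injective D] {f : B ⟶ C} {b : D ⟶ C}
    (h : ∃ a : B ⟶ D, a ≫ b = f) : FactorsThruInjective f :=
  let ⟨a, ha⟩ := h
  ⟨D, inferInstance, a, b, ha⟩

lemma cosyzygyIterMap_id_sub (n : ℕ) (B : A) :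
    FactorsThruInjective (cosyzygyIterMap n (𝟙 B) - 𝟙 _) := by
  induction n with
  | zero => exact (sub_self (𝟙 B)).symm ▸ FactorsThruInjective.zero B B
  | succ n ih =>
    exact .of_factor (cosyzygyMap_sub _ (𝟙 _) (𝟙 _) (𝟙 _) (by simp) (by simp) ih)

lemma cosyzygyIterMap_comp_sub (n : ℕ) {B C D : A} (f : B ⟶ C) (g : C ⟶ D) :
    FactorsThruInjective
      (cosyzygyIterMap n (f ≫ g) - cosyzygyIterMap n f ≫ cosyzygyIterMap n g) := by
  induction n with
  | zero => exact (sub_self (f ≫ g)).symm ▸ FactorsThruInjective.zero B D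
  | succ n ih =>
    exact .of_factor (cosyzygyMap_comp_sub _ _ _ ih)

/-! ### The functors `G ∘ Σⁿ` for a contravariant functor `G` that vanishes on injectives -/

/-- A contravariant functor vanishes on injectives. -/
class VanishesOnInjectives (G : Aᵒᵖ ⥤ AddCommGrpCat.{w}) : Prop where
  isZero (I : A) [Injective I] : IsZero (G.obj (op I))

lemma map_eq_of_factors (G : Aᵒᵖ ⥤ AddCommGrpCat.{w}) [G.Additive] [VanishesOnInjectives G]
    {B C : A} {f g : B ⟶ C} (h : FactorsThruInjective (f - g)) : G.map f.op = G.map g.op := by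
  obtain ⟨I, hI, a, b, hab⟩ := h
  rw [← sub_eq_zero, ← G.map_sub, ← op_sub, ← hab, op_comp, G.map_comp,
    (VanishesOnInjectives.isZero (G := G) I).eq_of_tgt (G.map b.op) 0, zero_comp]

/-- The functor `G ∘ Σⁿ`, for an additive contravariant functor `G` vanishing on injectives. -/
def compCosyzygy (G : Aᵒᵖ ⥤ AddCommGrpCat.{w}) [G.Additive] [VanishesOnInjectives G] (n : ℕ) :
    Aᵒᵖ ⥤ AddCommGrpCat.{w} where
  obj X := G.obj (op (cosyzygyIter n X.unop))
  map f := G.map (cosyzygyIterMap n f.unop).op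
  map_id X := (map_eq_of_factors G (cosyzygyIterMap_id_sub n X.unop)).trans (by simp)
  map_comp f g :=
    (map_eq_of_factors G (cosyzygyIterMap_comp_sub n g.unop f.unop)).trans (by simp)

/-! ### The quot-stabilization -/

section

variable (F : Aᵒᵖ ⥤ AddCommGrpCat.{w}) [F.Additive]

/-- The quot-stabilization of `F`: the cokernel of `λ_F : L⁰F ⟶ F`. -/
def quotStab : Aᵒᵖ ⥤ AddCommGrpCat.{w} := cokernel F.fromLeftDerivedZero

/-- The canonical epimorphism from `F` to its quot-stabilization. -/
def toQuotStab : F ⟶ quotStab F := cokernel.π F.fromLeftDerivedZero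

instance : Epi (toQuotStab F) :=
  inferInstanceAs (Epi (cokernel.π F.fromLeftDerivedZero))

instance (X : Aᵒᵖ) : Epi ((toQuotStab F).app X) := inferInstance

instance : (quotStab F).Additive where
  map_add {X Y f g} := by
    rw [← cancel_epi ((toQuotStab F).app X), ← (toQuotStab F).naturality, F.map_add,
      Preadditive.comp_add, Preadditive.add_comp, (toQuotStab F).naturality,
      (toQuotStab F).naturality]

lemma fromLeftDerivedZero_toQuotStab : F.fromLeftDerivedZero ≫ toQuotStab F = 0 :=
  cokernel.condition F.fromLeftDerivedZero

lemma fromLeftDerivedZero_toQuotStab_app (X : Aᵒᵖ) :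
    F.fromLeftDerivedZero.app X ≫ (toQuotStab F).app X = 0 := by
  rw [← NatTrans.comp_app, fromLeftDerivedZero_toQuotStab, zero_app]

instance : VanishesOnInjectives (quotStab F) where
  isZero I _ := by
    have h := fromLeftDerivedZero_toQuotStab_app F (op I)
    have h' : (toQuotStab F).app (op I) = 0 := by
      rw [← cancel_epi (F.fromLeftDerivedZero.app (op I)), h, comp_zero]
    exact IsZero.of_epi_eq_zero _ h'

/-! ### The left satellites -/

lemma kernel_ι_map_factor {B C : A} {k : cosyzygy B ⟶ cosyzygy C}
    (h : ∃ a : cosyzygy B ⟶ Injective.under C, a ≫ toCosyzygy C = k) :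
    kernel.ι (F.map (toCosyzygy C).op) ≫ F.map k.op = 0 := by
  obtain ⟨a, rfl⟩ := h
  rw [op_comp, F.map_comp, kernel.condition_assoc, zero_comp]

/-- The first left satellite `S₁F` of `F`, with value `Ker (F (Σ B) ⟶ F I)` at `B`, where `I` is
the injective container of `B`. -/
def satelliteOne : Aᵒᵖ ⥤ AddCommGrpCat.{w} where
  obj X := kernel (F.map (toCosyzygy X.unop).op)
  map f := kernel.map _ _ (F.map (cosyzygyMap f.unop).op) (F.map (containerMap f.unop).op) (by
    rw [← F.map_comp, ← F.map_comp, ← op_comp, ← op_comp, toCosyzygy_cosyzygyMap])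
  map_id X := by
    rw [← cancel_mono (kernel.ι _), kernel.lift_ι, unop_id, Category.id_comp, ← sub_eq_zero]
    refine Eq.trans ?_ (kernel_ι_map_factor F (cosyzygyMap_id_sub X.unop))
    rw [op_sub, F.map_sub, Preadditive.comp_sub, op_id, F.map_id, Category.comp_id]
  map_comp {X Y Z} f g := by
    rw [← cancel_mono (kernel.ι _), kernel.lift_ι, Category.assoc, kernel.lift_ι,
      kernel.lift_ι_assoc, ← sub_eq_zero]
    refine Eq.trans ?_ (kernel_ι_map_factor F (cosyzygyMap_comp_sub (g.unop ≫ f.unop) g.unop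
      f.unop (by rw [sub_self]; exact .zero _ _)))
    rw [op_sub, F.map_sub, Preadditive.comp_sub, op_comp, F.map_comp, Category.assoc, unop_comp]

/-- The canonical monomorphism `S₁F(B) ⟶ F(Σ B)`. -/
def satelliteOneι (B : A) : (satelliteOne F).obj (op B) ⟶ F.obj (op (cosyzygy B)) :=
  kernel.ι (F.map (toCosyzygy B).op)

instance (B : A) : Mono (satelliteOneι F B) :=
  inferInstanceAs (Mono (kernel.ι (F.map (toCosyzygy B).op)))

lemma satelliteOneι_map (B : A) : satelliteOneι F B ≫ F.map (toCosyzygy B).op = 0 :=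
  kernel.condition _

lemma satelliteOneι_naturality {B C : A} (f : B ⟶ C) :
    (satelliteOne F).map f.op ≫ satelliteOneι F B =
      satelliteOneι F C ≫ F.map (cosyzygyMap f).op :=
  kernel.lift_ι _ _ _

instance : (satelliteOne F).Additive where
  map_add {X Y f g} := by
    refine (cancel_mono (satelliteOneι F Y.unop)).1 ?_
    rw [Preadditive.add_comp]
    refine (satelliteOneι_naturality F (f + g).unop).trans ?_
    refine Eq.trans ?_ (congrArg₂ (· + ·) (satelliteOneι_naturality F f.unop)
      (satelliteOneι_naturality F g.unop)).symm
    rw [← Preadditive.comp_add, ← F.map_add, ← sub_eq_zero, ← Preadditive.comp_sub, ← F.map_sub,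
      ← op_add, ← op_sub]
    exact kernel_ι_map_factor F (cosyzygyMap_sub (f + g).unop (f.unop + g.unop) _
      (containerMap f.unop + containerMap g.unop)
      (by simp only [Preadditive.comp_add, Preadditive.add_comp, ι_containerMap])
      (by simp only [Preadditive.comp_add, Preadditive.add_comp, toCosyzygy_cosyzygyMap])
      (by rw [unop_add, sub_self]; exact .zero _ _))

instance : VanishesOnInjectives (satelliteOne F) where
  isZero I _ := by
    refine IsZero.of_mono_eq_zero (satelliteOneι F I) ?_
    have h : ∃ a : cosyzygy I ⟶ Injective.under I, a ≫ toCosyzygy I = 𝟙 _ :=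
      exists_factor (f := 𝟙 I) ⟨I, inferInstance, 𝟙 _, 𝟙 _, by simp⟩ (𝟙 _) _ (by simp) (by simp)
    have := kernel_ι_map_factor F h
    rw [op_id, F.map_id, Category.comp_id] at this
    exact this

/-- The left satellites: `S₀F = F`, and, by dimension shift, `S_{n+1}F = S₁F ∘ Σⁿ`. -/
def satellite : ℕ → (Aᵒᵖ ⥤ AddCommGrpCat.{w})
  | 0 => F
  | n + 1 => compCosyzygy (satelliteOne F) n

end

/-! ### The injective resolution built from the iterated cosyzygies -/

section

variable (B : A)

/-- The `n`-th term `Iⁿ` of the injective resolution of `B`: the injective container of `Σⁿ B`. -/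
def container (n : ℕ) : A := Injective.under (cosyzygyIter n B)

instance (n : ℕ) : Injective (container B n) :=
  inferInstanceAs (Injective (Injective.under _))

/-- The monomorphism `Σⁿ B ⟶ Iⁿ`. -/
def intoContainer (n : ℕ) : cosyzygyIter n B ⟶ container B n := Injective.ι _

/-- The epimorphism `Iⁿ ⟶ Σⁿ⁺¹ B`. -/
def fromContainer (n : ℕ) : container B n ⟶ cosyzygyIter (n + 1) B := toCosyzygy _

instance (n : ℕ) : Mono (intoContainer B n) := inferInstanceAs (Mono (Injective.ι _))

instance (n : ℕ) : Epi (fromContainer B n) := inferInstanceAs (Epi (toCosyzygy _))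

lemma into_from (n : ℕ) : intoContainer B n ≫ fromContainer B n = 0 := ι_toCosyzygy _

/-- The differential `Iⁿ ⟶ Σⁿ⁺¹ B ⟶ Iⁿ⁺¹`. -/
def containerD (n : ℕ) : container B n ⟶ container B (n + 1) :=
  fromContainer B n ≫ intoContainer B (n + 1)

lemma into_containerD (n : ℕ) : intoContainer B n ≫ containerD B n = 0 := by
  rw [containerD, ← Category.assoc, into_from, zero_comp]

lemma containerD_comp (n : ℕ) : containerD B n ≫ containerD B (n + 1) = 0 := by
  rw [containerD, Category.assoc, into_containerD, comp_zero]

lemma exact_into_from (n : ℕ) : (ShortComplex.mk _ _ (into_from B n)).Exact :=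
  ShortComplex.exact_cokernel (Injective.ι (cosyzygyIter n B))

lemma exact_into_containerD (n : ℕ) : (ShortComplex.mk _ _ (into_containerD B n)).Exact := by
  let φ : ShortComplex.mk _ _ (into_from B n) ⟶ ShortComplex.mk _ _ (into_containerD B n) :=
    { τ₁ := 𝟙 _, τ₂ := 𝟙 _, τ₃ := intoContainer B (n + 1) }
  have h₁ : Epi φ.τ₁ := inferInstanceAs (Epi (𝟙 _))
  have h₂ : IsIso φ.τ₂ := inferInstanceAs (IsIso (𝟙 _))
  have h₃ : Mono φ.τ₃ := inferInstanceAs (Mono (intoContainer B (n + 1)))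
  exact (ShortComplex.exact_iff_of_epi_of_isIso_of_mono φ).1 (exact_into_from B n)

lemma exact_containerD (n : ℕ) : (ShortComplex.mk _ _ (containerD_comp B n)).Exact := by
  let φ : ShortComplex.mk _ _ (containerD_comp B n) ⟶
      ShortComplex.mk _ _ (into_containerD B (n + 1)) :=
    { τ₁ := fromContainer B n, τ₂ := 𝟙 _, τ₃ := 𝟙 _, comm₁₂ := by simp [containerD] }
  have h₁ : Epi φ.τ₁ := inferInstanceAs (Epi (fromContainer B n))
  have h₂ : IsIso φ.τ₂ := inferInstanceAs (IsIso (𝟙 _))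
  have h₃ : Mono φ.τ₃ := inferInstanceAs (Mono (𝟙 _))
  exact (ShortComplex.exact_iff_of_epi_of_isIso_of_mono φ).2 (exact_into_containerD B (n + 1))

lemma containerD_op_comp (n : ℕ) : (containerD B (n + 1)).op ≫ (containerD B n).op = 0 := by
  rw [← op_comp, containerD_comp, op_zero]

/-- The complex `⋯ ⟶ I² ⟶ I¹ ⟶ I⁰` in the opposite category. -/
def resolutionComplex : ChainComplex Aᵒᵖ ℕ :=
  ChainComplex.of (fun n => op (container B n)) (fun n => (containerD B n).op)
    (containerD_op_comp B)

lemma resolutionComplex_d (n : ℕ) :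
    (resolutionComplex B).d (n + 1) n = (containerD B n).op :=
  ChainComplex.of_d (V := Aᵒᵖ) (fun n => op (container B n)) (fun n => (containerD B n).op) n

lemma resolutionComplex_d_zero :
    (resolutionComplex B).d 1 0 ≫ (intoContainer B 0).op = 0 := by
  rw [resolutionComplex_d]
  refine op_comp.symm.trans ?_
  rw [into_containerD, op_zero]
  rfl

/-- The augmentation of `resolutionComplex B`, given by `B ⟶ I⁰`. -/
def resolutionπ : resolutionComplex B ⟶ (ChainComplex.single₀ Aᵒᵖ).obj (op B) :=
  (ChainComplex.toSingle₀Equiv _ _).symm ⟨(intoContainer B 0).op, resolutionComplex_d_zero B⟩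

lemma resolutionπ_f_zero : (resolutionπ B).f 0 = (intoContainer B 0).op :=
  ChainComplex.toSingle₀Equiv_symm_apply_f_zero (C := resolutionComplex B) (X := op B)
    (intoContainer B 0).op (resolutionComplex_d_zero B)

/-- The injective resolution `0 ⟶ B ⟶ I⁰ ⟶ I¹ ⟶ ⋯`, as a projective resolution of `B` in the
opposite category. -/
def resolution : ProjectiveResolution (op B) where
  complex := resolutionComplex B
  projective n := inferInstanceAs (Projective (op (container B n)))
  π := resolutionπ B
  quasiIso := ⟨fun n => by
    cases n with
    | zero =>
      rw [ChainComplex.quasiIsoAt₀_iff, ShortComplex.quasiIso_iff_of_zeros']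
      · refine (ShortComplex.exact_and_epi_g_iff_of_iso ?_).2
          ⟨(exact_into_containerD B 0).op, inferInstanceAs (Epi (intoContainer B 0).op)⟩
        exact ShortComplex.isoMk (Iso.refl _) (Iso.refl _) (Iso.refl _)
          (by
            refine (Category.id_comp _).trans (Eq.trans ?_ (Category.comp_id _).symm)
            exact (resolutionComplex_d B 0).symm)
          (by
            refine (Category.id_comp _).trans (Eq.trans ?_ (Category.comp_id _).symm)
            exact (resolutionπ_f_zero B).symm)
      all_goals rfl
    | succ n =>
      rw [quasiIsoAt_iff_exactAt' _ _ (ChainComplex.exactAt_succ_single_obj (C := Aᵒᵖ) (op B) n),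
        HomologicalComplex.exactAt_iff' _ (n + 1 + 1) (n + 1) n (by simp) (by simp)]
      refine (ShortComplex.exact_iff_of_iso ?_).1 (exact_containerD B n).op
      exact ShortComplex.isoMk (Iso.refl _) (Iso.refl _) (Iso.refl _)
          (by
            refine (Category.id_comp _).trans (Eq.trans ?_ (Category.comp_id _).symm)
            exact (resolutionComplex_d B (n + 1)))
          (by
            refine (Category.id_comp _).trans (Eq.trans ?_ (Category.comp_id _).symm)
            exact (resolutionComplex_d B n))⟩

end

/-- The morphism of injective resolutions induced by `f`, on the `n`-th terms. -/
def containerIterMap {B C : A} (f : B ⟶ C) (n : ℕ) : container B n ⟶ container C n :=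
  containerMap (cosyzygyIterMap n f)

lemma into_containerIterMap {B C : A} (f : B ⟶ C) (n : ℕ) :
    intoContainer B n ≫ containerIterMap f n = cosyzygyIterMap n f ≫ intoContainer C n :=
  ι_containerMap _

lemma from_cosyzygyIterMap {B C : A} (f : B ⟶ C) (n : ℕ) :
    fromContainer B n ≫ cosyzygyIterMap (n + 1) f = containerIterMap f n ≫ fromContainer C n :=
  toCosyzygy_cosyzygyMap _

lemma containerD_containerIterMap {B C : A} (f : B ⟶ C) (n : ℕ) :
    containerD B n ≫ containerIterMap f (n + 1) = containerIterMap f n ≫ containerD C n := by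
  rw [containerD, Category.assoc, into_containerIterMap, ← Category.assoc, from_cosyzygyIterMap,
    Category.assoc, containerD]

/-- The morphism of resolutions induced by `f`, in the opposite category. -/
def resolutionMap {B C : A} (f : B ⟶ C) : (resolution C).complex ⟶ (resolution B).complex :=
  ChainComplex.ofHom (fun n => (containerIterMap f n).op) (fun n => by
    refine (congrArg _ (resolutionComplex_d B n)).trans
      (Eq.trans ?_ (congrArg (· ≫ _) (resolutionComplex_d C n).symm))
    exact congrArg Quiver.Hom.op (containerD_containerIterMap f n))

lemma resolutionMap_π {B C : A} (f : B ⟶ C) :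
    (resolutionMap f).f 0 ≫ (resolution B).π.f 0 = (resolution C).π.f 0 ≫ f.op := by
  refine (congrArg _ (resolutionπ_f_zero B)).trans
      (Eq.trans ?_ (congrArg (· ≫ f.op) (resolutionπ_f_zero C).symm))
  exact congrArg Quiver.Hom.op (into_containerIterMap f 0)

/-! ### The morphisms of the left fundamental sequence -/

/-- Auxiliary data: factorizations `K_{n+1} ⟶ M_{n+1} ⟶ K_n` of the differentials of a complex `K` through given
objects, with `M_{n+1} ⟶ K_n ⟶ M_n` zero. -/
structure Splicing (K : ChainComplex AddCommGrpCat.{w} ℕ) where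
  M : ℕ → AddCommGrpCat.{w}
  e : ∀ n, M (n + 1) ⟶ K.X n
  i : ∀ n, K.X n ⟶ M n
  e_i : ∀ n, e n ≫ i n = 0
  d_eq : ∀ n, K.d (n + 1) n = i (n + 1) ≫ e n

namespace Splicing

variable {K : ChainComplex AddCommGrpCat.{w} ℕ} (S : Splicing K)

lemma e_d (n j : ℕ) : S.e n ≫ K.d n j = 0 := by
  by_cases h : j + 1 = n
  · subst h
    rw [S.d_eq, ← Category.assoc, S.e_i, zero_comp]
  · rw [K.shape _ _ h, comp_zero]

/-- The map `M_{n+1} ⟶ H_n(K)` induced by `M_{n+1} ⟶ K_n`, whose image consists of cycles. -/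
def toHomology (n : ℕ) : S.M (n + 1) ⟶ K.homology n :=
  K.liftCycles (S.e n) _ rfl (S.e_d n _) ≫ K.homologyπ n

lemma i_d (n : ℕ) : K.d (n + 1) n ≫ S.i n = 0 := by
  rw [S.d_eq, Category.assoc, S.e_i, comp_zero]

/-- The map `H_n(K) ⟶ M_n` induced by `K_n ⟶ M_n`, which vanishes on the boundaries. -/
def fromHomology (n : ℕ) : K.homology n ⟶ S.M n :=
  K.homologyι n ≫ K.descOpcycles (S.i n) (n + 1) (by simp) (S.i_d n)

lemma i_toHomology (n : ℕ) : S.i (n + 1) ≫ S.toHomology n = 0 := by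
  have h : S.i (n + 1) ≫ K.liftCycles (S.e n) _ rfl (S.e_d n _) = K.toCycles (n + 1) n := by
    rw [← cancel_mono (K.iCycles n), Category.assoc, K.liftCycles_i, K.toCycles_i, S.d_eq]
  rw [toHomology, ← Category.assoc, h, K.toCycles_comp_homologyπ]

lemma π_fromHomology (n : ℕ) : K.homologyπ n ≫ S.fromHomology n = K.iCycles n ≫ S.i n := by
  rw [fromHomology, K.homology_π_ι_assoc, K.p_descOpcycles]

lemma fromHomology_e (n : ℕ) : S.fromHomology (n + 1) ≫ S.e n = 0 := by
  rw [← cancel_epi (K.homologyπ (n + 1)), ← Category.assoc, π_fromHomology, Category.assoc,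
    ← S.d_eq, K.iCycles_d, comp_zero]

variable {L : ChainComplex AddCommGrpCat.{w} ℕ} (T : Splicing L)

lemma toHomology_naturality (φ : K ⟶ L) (n : ℕ) (ψ : S.M (n + 1) ⟶ T.M (n + 1))
    (h : ψ ≫ T.e n = S.e n ≫ φ.f n) :
    ψ ≫ T.toHomology n = S.toHomology n ≫ HomologicalComplex.homologyMap φ n := by
  have h' : ψ ≫ L.liftCycles (T.e n) _ rfl (T.e_d n _) =
      K.liftCycles (S.e n) _ rfl (S.e_d n _) ≫ HomologicalComplex.cyclesMap φ n := by
    rw [← cancel_mono (L.iCycles n), Category.assoc, Category.assoc, L.liftCycles_i,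
      HomologicalComplex.cyclesMap_i, K.liftCycles_i_assoc, h]
  rw [toHomology, toHomology, Category.assoc, HomologicalComplex.homologyπ_naturality,
    ← Category.assoc, h', Category.assoc]

lemma fromHomology_naturality (φ : K ⟶ L) (n : ℕ) (ψ : S.M n ⟶ T.M n)
    (h : S.i n ≫ ψ = φ.f n ≫ T.i n) :
    HomologicalComplex.homologyMap φ n ≫ T.fromHomology n = S.fromHomology n ≫ ψ := by
  rw [← cancel_epi (K.homologyπ n), HomologicalComplex.homologyπ_naturality_assoc,
    π_fromHomology, ← Category.assoc, ← Category.assoc, π_fromHomology,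
    HomologicalComplex.cyclesMap_i, Category.assoc, Category.assoc, h]

end Splicing

variable (F : Aᵒᵖ ⥤ AddCommGrpCat.{w}) [F.Additive]

lemma map_op_comp {B C D : A} (f : B ⟶ C) (g : C ⟶ D) :
    F.map (f ≫ g).op = F.map g.op ≫ F.map f.op :=
  F.map_comp g.op f.op

/-- The complex `⋯ ⟶ F(I²) ⟶ F(I¹) ⟶ F(I⁰)`. -/
def imageComplex (B : A) : ChainComplex AddCommGrpCat.{w} ℕ :=
  (F.mapHomologicalComplex _).obj (resolution B).complex

/-- The morphism of complexes induced by `f : B ⟶ C`. -/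
def imageComplexMap {B C : A} (f : B ⟶ C) : imageComplex F C ⟶ imageComplex F B :=
  (F.mapHomologicalComplex _).map (resolutionMap f)

/-- The factorizations `F(Iⁿ⁺¹) ⟶ F(Σⁿ⁺¹B) ⟶ F(Iⁿ)`. -/
def imageSplicing (B : A) : Splicing (imageComplex F B) where
  M n := F.obj (op (cosyzygyIter n B))
  e n := F.map (fromContainer B n).op
  i n := F.map (intoContainer B n).op
  e_i n := (F.map_comp _ _).symm.trans
    ((congrArg (fun t => F.map t.op) (into_from B n)).trans (F.map_zero _ _))
  d_eq n := (congrArg F.map (resolutionComplex_d B n)).trans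
    (map_op_comp F (fromContainer B n) (intoContainer B (n + 1)))

/-- `LⁿF(B)` is the `n`-th homology of `imageComplex F B`. -/
def leftDerivedIso (B : A) (n : ℕ) :
    (F.leftDerived n).obj (op B) ≅ (imageComplex F B).homology n :=
  (resolution B).isoLeftDerivedObj F n

lemma leftDerivedIso_hom_naturality {B C : A} (f : B ⟶ C) (n : ℕ) :
    (F.leftDerived n).map f.op ≫ (leftDerivedIso F B n).hom =
      (leftDerivedIso F C n).hom ≫ HomologicalComplex.homologyMap (imageComplexMap F f) n :=
  ProjectiveResolution.isoLeftDerivedObj_hom_naturality f.op (resolution C) (resolution B)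
    (resolutionMap f) (resolutionMap_π f) F n

lemma leftDerivedIso_inv_naturality {B C : A} (f : B ⟶ C) (n : ℕ) :
    (leftDerivedIso F C n).inv ≫ (F.leftDerived n).map f.op =
      HomologicalComplex.homologyMap (imageComplexMap F f) n ≫ (leftDerivedIso F B n).inv :=
  ProjectiveResolution.isoLeftDerivedObj_inv_naturality f.op (resolution C) (resolution B)
    (resolutionMap f) (resolutionMap_π f) F n

/-- The map `F(Σⁿ⁺¹B) ⟶ LⁿF(B)` induced by `Iⁿ ⟶ Σⁿ⁺¹B`. -/
def toLeftDerived (B : A) (n : ℕ) :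
    F.obj (op (cosyzygyIter (n + 1) B)) ⟶ (F.leftDerived n).obj (op B) :=
  (imageSplicing F B).toHomology n ≫ (leftDerivedIso F B n).inv

lemma toLeftDerived_naturality {B C : A} (f : B ⟶ C) (n : ℕ) :
    F.map (cosyzygyIterMap (n + 1) f).op ≫ toLeftDerived F B n =
      toLeftDerived F C n ≫ (F.leftDerived n).map f.op := by
  have h := (imageSplicing F C).toHomology_naturality (imageSplicing F B) (imageComplexMap F f) n
    (F.map (cosyzygyIterMap (n + 1) f).op) ((map_op_comp F _ _).symm.trans (Eq.trans
      (congrArg (fun t => F.map t.op) (from_cosyzygyIterMap f n)) (map_op_comp F _ _)))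
  refine (Category.assoc _ _ _).symm.trans ((congrArg (· ≫ _) h).trans ?_)
  exact (Category.assoc _ _ _).trans (Eq.trans (congrArg ((imageSplicing F C).toHomology n ≫ ·)
    (leftDerivedIso_inv_naturality F f n).symm) (Category.assoc _ _ _).symm)

lemma map_into_toLeftDerived (B : A) (n : ℕ) :
    F.map (intoContainer B (n + 1)).op ≫ toLeftDerived F B n = 0 :=
  (Category.assoc _ _ _).symm.trans
    ((congrArg (· ≫ _) ((imageSplicing F B).i_toHomology n)).trans zero_comp)

/-- The map `LⁿF(B) ⟶ F(ΣⁿB)` induced by `ΣⁿB ⟶ Iⁿ`. -/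
def fromLeftDerived (B : A) (n : ℕ) :
    (F.leftDerived n).obj (op B) ⟶ F.obj (op (cosyzygyIter n B)) :=
  (leftDerivedIso F B n).hom ≫ (imageSplicing F B).fromHomology n

lemma fromLeftDerived_naturality {B C : A} (f : B ⟶ C) (n : ℕ) :
    (F.leftDerived n).map f.op ≫ fromLeftDerived F B n =
      fromLeftDerived F C n ≫ F.map (cosyzygyIterMap n f).op := by
  have h := (imageSplicing F C).fromHomology_naturality (imageSplicing F B) (imageComplexMap F f) n
    (F.map (cosyzygyIterMap n f).op) ((map_op_comp F _ _).symm.trans (Eq.trans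
      (congrArg (fun t => F.map t.op) (into_containerIterMap f n).symm) (map_op_comp F _ _)))
  refine (Category.assoc _ _ _).symm.trans
    ((congrArg (· ≫ _) (leftDerivedIso_hom_naturality F f n)).trans ?_)
  exact (Category.assoc _ _ _).trans (Eq.trans (congrArg ((leftDerivedIso F C n).hom ≫ ·) h)
    (Category.assoc _ _ _).symm)

lemma fromLeftDerived_map_from (B : A) (n : ℕ) :
    fromLeftDerived F B (n + 1) ≫ F.map (fromContainer B n).op = 0 :=
  (Category.assoc _ _ _).trans
    ((congrArg (_ ≫ ·) ((imageSplicing F B).fromHomology_e n)).trans comp_zero)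

/-- The map `Lⁿ⁺¹F(B) ⟶ S₁F(ΣⁿB) = S_{n+1}F(B)` induced by `Σⁿ⁺¹B ⟶ Iⁿ⁺¹`. -/
def toSatellite (B : A) (n : ℕ) :
    (F.leftDerived (n + 1)).obj (op B) ⟶ (satelliteOne F).obj (op (cosyzygyIter n B)) :=
  kernel.lift (F.map (toCosyzygy (cosyzygyIter n B)).op)
    (fromLeftDerived F B (n + 1)) (fromLeftDerived_map_from F B n)

lemma toSatellite_ι (B : A) (n : ℕ) :
    toSatellite F B n ≫ satelliteOneι F (cosyzygyIter n B) = fromLeftDerived F B (n + 1) :=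
  kernel.lift_ι _ _ _

lemma toSatellite_naturality {B C : A} (f : B ⟶ C) (n : ℕ) :
    (F.leftDerived (n + 1)).map f.op ≫ toSatellite F B n =
      toSatellite F C n ≫ (satelliteOne F).map (cosyzygyIterMap n f).op := by
  rw [← cancel_mono (satelliteOneι F (cosyzygyIter n B)), Category.assoc, Category.assoc,
    toSatellite_ι, satelliteOneι_naturality, ← Category.assoc, toSatellite_ι]
  exact fromLeftDerived_naturality F f (n + 1)

/-- The morphism `LⁿF ⟶ SₙF`. For `n = 0` it is `λ_F : L⁰F ⟶ F`; in positive degrees it is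
induced by the monomorphisms `ΣⁿB ⟶ Iⁿ`. -/
def derivedToSatellite : (n : ℕ) → (F.leftDerived n ⟶ satellite F n)
  | 0 => F.fromLeftDerivedZero
  | n + 1 =>
    { app := fun X => toSatellite F X.unop n
      naturality := fun _ _ f => toSatellite_naturality F f.unop n }

/-- The morphism from `SₙF` to the quot-stabilization of `F` composed with `Σⁿ`. For `n = 0` it is
the canonical epimorphism from `F` to its quot-stabilization; for `n + 1` it is induced by the
inclusion `S₁F(ΣⁿB) ⟶ F(Σⁿ⁺¹B)`. -/
def satelliteToStab : (n : ℕ) → (satellite F n ⟶ compCosyzygy (quotStab F) n)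
  | 0 => toQuotStab F
  | n + 1 =>
    { app := fun X => satelliteOneι F (cosyzygyIter n X.unop) ≫
        (toQuotStab F).app (op (cosyzygyIter (n + 1) X.unop))
      naturality := fun X Y f => by
        refine (Category.assoc _ _ _).symm.trans ((congrArg (· ≫ _) (satelliteOneι_naturality F
          (cosyzygyIterMap n f.unop))).trans ?_)
        refine (Category.assoc _ _ _).trans (Eq.trans ?_ (Category.assoc _ _ _).symm)
        exact congrArg _ ((toQuotStab F).naturality (cosyzygyIterMap (n + 1) f.unop).op) }

lemma fromLeftDerivedZero_comp_eq_zero {B : A} {M : AddCommGrpCat.{w}} (k : F.obj (op B) ⟶ M)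
    (hk : F.map (Injective.ι B).op ≫ k = 0) : F.fromLeftDerivedZero.app (op B) ≫ k = 0 := by
  have h : (resolution B).fromLeftDerivedZero' F ≫ k = 0 := by
    rw [← cancel_epi (HomologicalComplex.pOpcycles _ _),
      ProjectiveResolution.pOpcycles_comp_fromLeftDerivedZero'_assoc, comp_zero]
    exact (congrArg (fun t => F.map t ≫ k) (resolutionπ_f_zero B)).trans hk
  refine (congrArg (· ≫ k) ((resolution B).fromLeftDerivedZero_eq F)).trans ?_
  refine (Category.assoc _ _ _).trans ((congrArg (_ ≫ ·)
    ((Category.assoc _ _ _).trans ((congrArg (_ ≫ ·) h).trans comp_zero))).trans comp_zero)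

/-- The quot-stabilization of `F` at `B` is the cokernel of `λ_F` at `B`. -/
def isColimitToQuotStab (B : A) :
    IsColimit (CokernelCofork.ofπ ((toQuotStab F).app (op B))
      (fromLeftDerivedZero_toQuotStab_app F (op B))) :=
  CokernelCofork.mapIsColimit _ (cokernelIsCokernel F.fromLeftDerivedZero)
    ((evaluation _ _).obj (op B))

/-- The map from the quot-stabilization of `F` at `B` induced by a map from `F(B)` that vanishes
on the image of `F(I)`, where `I` is the injective container of `B`. -/
def stabDesc {B : A} {M : AddCommGrpCat.{w}} (k : F.obj (op B) ⟶ M)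
    (hk : F.map (Injective.ι B).op ≫ k = 0) : (quotStab F).obj (op B) ⟶ M :=
  (isColimitToQuotStab F B).desc
    (CokernelCofork.ofπ k (fromLeftDerivedZero_comp_eq_zero F k hk))

lemma toQuotStab_stabDesc {B : A} {M : AddCommGrpCat.{w}} (k : F.obj (op B) ⟶ M)
    (hk : F.map (Injective.ι B).op ≫ k = 0) :
    (toQuotStab F).app (op B) ≫ stabDesc F k hk = k :=
  (isColimitToQuotStab F B).fac
    (CokernelCofork.ofπ k (fromLeftDerivedZero_comp_eq_zero F k hk)) WalkingParallelPair.one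

/-- The morphism to `LⁿF` from the quot-stabilization of `F` composed with `Σⁿ⁺¹`, induced by the
epimorphisms `Iⁿ ⟶ Σⁿ⁺¹B`. For `n = 0` it is `α_F`. -/
def stabToDerived (n : ℕ) : compCosyzygy (quotStab F) (n + 1) ⟶ F.leftDerived n where
  app X := stabDesc F (toLeftDerived F X.unop n) (map_into_toLeftDerived F X.unop n)
  naturality X Y f := by
    refine (cancel_epi ((toQuotStab F).app (op (cosyzygyIter (n + 1) X.unop)))).1 ?_
    refine (Category.assoc _ _ _).symm.trans ((congrArg (· ≫ _) ((toQuotStab F).naturality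
      (cosyzygyIterMap (n + 1) f.unop).op).symm).trans ?_)
    refine (Category.assoc _ _ _).trans ((congrArg (_ ≫ ·) (toQuotStab_stabDesc F _ _)).trans ?_)
    refine (toLeftDerived_naturality F f.unop n).trans ?_
    exact (congrArg (· ≫ _) (toQuotStab_stabDesc F _ _).symm).trans (Category.assoc _ _ _)

/-- The natural transformation `α_F` from `F̲ ∘ Σ` to `L⁰F`, where `F̲` is the quot-stabilization. -/
abbrev alphaMap : compCosyzygy (quotStab F) 1 ⟶ F.leftDerived 0 := stabToDerived F 0

/-- Two consecutive morphisms compose to zero and the sequence they form is exact in the middle. -/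
def IsExactPair {C : Type*} [Category* C] [HasZeroMorphisms C] {X Y Z : C} (f : X ⟶ Y)
    (g : Y ⟶ Z) : Prop :=
  ∃ h : f ≫ g = 0, (ShortComplex.mk f g h).Exact

/-- A contravariant additive functor is half-exact if it carries each short exact sequence
`0 ⟶ X ⟶ Y ⟶ Z ⟶ 0` to a sequence `F Z ⟶ F Y ⟶ F X` exact in the middle. -/
def HalfExact : Prop :=
  ∀ S : ShortComplex A, S.ShortExact → (S.op.map F).Exact

end FundamentalSequence

end

namespace FundamentalSequence

/-! Fix `B`, put `Kₙ = F(Iⁿ)` and `Mₙ = F(ΣⁿB)`, and write `i : Kₙ ⟶ Mₙ` and `e : Mₙ₊₁ ⟶ Kₙ` for the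
maps induced by `ΣⁿB ↣ Iⁿ` and `Iⁿ ↠ Σⁿ⁺¹B`. The differential is `d = e ∘ i`, and `i ∘ e = 0`. At
`B` every term is read off from these maps: `Sₙ₊₁F` is `Ker e`, `F̲ ∘ Σⁿ` is `Coker i`
(`map_into_toQuotStab`, `exists_map_ι_eq`), and `LⁿF` is the homology of `K`.

Exactness is then a chase. An element of `Ker e` that dies in `Coker i` is some `i x` with `d x = e
(i x) = 0`, hence comes from the homology class of `x`. If `e y` is a boundary `e (i w)`, then `y -
i w` lies in `Ker e` and has the same class as `y` in `Coker i`. At `LⁿF` the homology is `Ker i /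
Im e`, which half-exactness kills when applied to `0 ⟶ ΣⁿB ⟶ Iⁿ ⟶ Σⁿ⁺¹B ⟶ 0`.

The map `α_F` is monic as soon as `S₁F ⟶ F̲ ∘ Σ` is zero, and `F̲` vanishes as soon as all `F(I) ⟶
F(B)` are epic. If `λ_F` is invertible, then `F(ΣB) ⟶ F(I) ⟶ F(B) ⟶ 0` is exact for the chosen
containers; `exact_and_epi_of_isIso` carries this over to arbitrary short exact sequences by
extending maps into injectives. -/

/-- A sequence of functors to abelian groups is exact if it is exact at each object. -/
lemma isExactPair_of_app {C : Type u} [Category.{v} C] {G₁ G₂ G₃ : C ⥤ AddCommGrpCat.{w}}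
    (f : G₁ ⟶ G₂) (g : G₂ ⟶ G₃) (h₀ : f ≫ g = 0)
    (h : ∀ X (y : G₂.obj X), g.app X y = 0 → ∃ x : G₁.obj X, f.app X x = y) :
    IsExactPair f g := by
  refine ⟨h₀, ?_⟩
  -- Evaluation at an object commutes with homology, so the homology functor is zero once all its
  -- values are.
  rw [ShortComplex.exact_iff_isZero_homology]
  refine Functor.isZero _ fun X => ?_
  have hX : ((ShortComplex.mk f g h₀).map ((evaluation _ _).obj X)).Exact :=
    (ShortComplex.ab_exact_iff _).2 (h X)
  exact ((ShortComplex.exact_iff_isZero_homology _).1 hX).of_iso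
    ((ShortComplex.mk f g h₀).mapHomologyIso ((evaluation _ _).obj X)).symm

lemma apply_eq_zero_of_comp {X Y Z : AddCommGrpCat.{w}} {f : X ⟶ Y} {g : Y ⟶ Z}
    (h : f ≫ g = 0) (x : X) : g (f x) = 0 := by
  rw [← ConcreteCategory.comp_apply, h]
  rfl

/-! ### Cycles and boundaries in terms of elements. -/

section

variable (K : ChainComplex AddCommGrpCat.{w} ℕ)

/-- The free index `j` covers degree `0` too, where `next 0 = 0` and the outgoing differential is
the zero map `d 0 0`. -/
lemma exists_iCycles_apply_eq (n j : ℕ) (hj : (ComplexShape.down ℕ).next n = j) (x : K.X n)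
    (hx : K.d n j x = 0) : ∃ z : K.cycles n, K.iCycles n z = x :=
  (ShortComplex.ab_exact_iff _).1 (ShortComplex.exact_of_f_is_kernel
    (ShortComplex.mk (K.iCycles n) (K.d n j) (K.iCycles_d n j)) (K.cyclesIsKernel n j hj)) x hx

lemma exists_toCycles_apply_eq (n : ℕ) (z : K.cycles n) (hz : K.homologyπ n z = 0) :
    ∃ w : K.X (n + 1), K.toCycles (n + 1) n w = z :=
  (ShortComplex.ab_exact_iff _).1 (ShortComplex.exact_of_g_is_cokernel
    (ShortComplex.mk (K.toCycles (n + 1) n) (K.homologyπ n) (K.toCycles_comp_homologyπ _ _))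
      (K.homologyIsCokernel (n + 1) n (by simp))) z hz

end

/-! ### Element chases in a spliced complex. -/

namespace Splicing

variable {K : ChainComplex AddCommGrpCat.{w} ℕ} (S : Splicing K)

lemma toHomology_fromHomology (n : ℕ) : S.toHomology n ≫ S.fromHomology n = 0 := by
  rw [toHomology, Category.assoc, π_fromHomology, K.liftCycles_i_assoc, e_i]

/-- The cycle `e y` is a boundary, and boundaries have the form `e (i w)`. Hence `y` differs from an
element of `Ker e` by an element of `Im i`, which gives exactness at `F̲ ∘ Σⁿ⁺¹`. -/
lemma exists_e_eq_of_toHomology_eq_zero (n : ℕ) (y : S.M (n + 1)) (hy : S.toHomology n y = 0) :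
    ∃ w : K.X (n + 1), S.e n (S.i (n + 1) w) = S.e n y := by
  obtain ⟨w, hw⟩ := exists_toCycles_apply_eq K n
    (K.liftCycles (S.e n) _ rfl (S.e_d n _) y) hy
  refine ⟨w, ?_⟩
  have h := congrArg (K.iCycles n) hw
  rwa [← ConcreteCategory.comp_apply, ← ConcreteCategory.comp_apply, K.toCycles_i,
    K.liftCycles_i, S.d_eq] at h

lemma toHomology_eq_zero (n : ℕ) (y : S.M (n + 1)) (hy : S.e n y = 0) :
    S.toHomology n y = 0 := by
  have h : K.liftCycles (S.e n) _ rfl (S.e_d n _) y = 0 := by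
    refine (AddCommGrpCat.mono_iff_injective (K.iCycles n)).1 inferInstance ?_
    rw [← ConcreteCategory.comp_apply, K.liftCycles_i, hy, map_zero]
  rw [toHomology, ConcreteCategory.comp_apply, h, map_zero]

lemma exists_fromHomology_eq (n j : ℕ) (hj : (ComplexShape.down ℕ).next n = j) (x : K.X n)
    (hx : K.d n j x = 0) : ∃ h : K.homology n, S.fromHomology n h = S.i n x := by
  obtain ⟨z, rfl⟩ := exists_iCycles_apply_eq K n j hj x hx
  exact ⟨K.homologyπ n z, by
    rw [← ConcreteCategory.comp_apply, S.π_fromHomology, ConcreteCategory.comp_apply]⟩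

/-- A cycle representing `h` is killed by `i`, so `hS` lifts it along `e`. This hypothesis is the
only point at which half-exactness is needed. -/
lemma exists_toHomology_eq (n : ℕ) (hS : ∀ x, S.i n x = 0 → ∃ y, S.e n y = x)
    (h : K.homology n) (hh : S.fromHomology n h = 0) : ∃ y, S.toHomology n y = h := by
  obtain ⟨z, rfl⟩ := (AddCommGrpCat.epi_iff_surjective (K.homologyπ n)).1 inferInstance h
  rw [← ConcreteCategory.comp_apply, S.π_fromHomology, ConcreteCategory.comp_apply] at hh
  obtain ⟨y, hy⟩ := hS _ hh
  refine ⟨y, ?_⟩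
  rw [toHomology, ConcreteCategory.comp_apply]
  congr 1
  refine (AddCommGrpCat.mono_iff_injective (K.iCycles n)).1 inferInstance ?_
  rw [← ConcreteCategory.comp_apply, K.liftCycles_i, hy]

end Splicing

/-! ### Derived functors and the quot-stabilization at an object. -/

variable {A : Type u} [Category.{v} A] [Abelian A] [EnoughInjectives A]
variable (F : Aᵒᵖ ⥤ AddCommGrpCat.{w}) [F.Additive]

/-- Restricted to the cycles of degree `0`, both maps are `F(I⁰) ⟶ F(B)`. This lets degree `0` be
treated like the positive degrees. -/
lemma fromLeftDerived_zero_eq (B : A) :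
    fromLeftDerived F B 0 = F.fromLeftDerivedZero.app (op B) := by
  refine Eq.trans ?_ ((resolution B).fromLeftDerivedZero_eq F).symm
  refine congrArg ((leftDerivedIso F B 0).hom ≫ ·) ?_
  refine (cancel_epi ((imageComplex F B).homologyπ 0)).1 ?_
  refine ((imageSplicing F B).π_fromHomology 0).trans ?_
  refine Eq.trans ?_ ((imageComplex F B).homology_π_ι_assoc 0 _).symm
  refine congrArg ((imageComplex F B).iCycles 0 ≫ ·) (Eq.symm ?_)
  refine ((resolution B).pOpcycles_comp_fromLeftDerivedZero' F).trans ?_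
  exact congrArg F.map (resolutionπ_f_zero B)

/-- By naturality the composite passes through `F̲(I) = 0`. -/
lemma map_into_toQuotStab (B : A) :
    F.map (Injective.ι B).op ≫ (toQuotStab F).app (op B) = 0 := by
  rw [(toQuotStab F).naturality, (VanishesOnInjectives.isZero (G := quotStab F)
    (Injective.under B)).eq_of_tgt ((toQuotStab F).app _) 0, zero_comp]

/-- The projection of `F(B)` onto the cokernel of `F(I) ⟶ F(B)` factors through `F̲(B)`. With
`map_into_toQuotStab`, this identifies `F̲(B)` with that cokernel. -/
lemma exists_map_ι_eq (B : A) (y : F.obj (op B)) (hy : (toQuotStab F).app (op B) y = 0) :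
    ∃ x : F.obj (op (Injective.under B)), F.map (Injective.ι B).op x = y := by
  have h : cokernel.π (F.map (Injective.ι B).op) y = 0 := by
    rw [← toQuotStab_stabDesc F (cokernel.π (F.map (Injective.ι B).op)) (cokernel.condition _),
      ConcreteCategory.comp_apply, hy, map_zero]
  exact (ShortComplex.ab_exact_iff _).1
    (ShortComplex.exact_cokernel (F.map (Injective.ι B).op)) y h

lemma toQuotStab_surjective (X : Aᵒᵖ) : Function.Surjective ((toQuotStab F).app X) :=
  (AddCommGrpCat.epi_iff_surjective _).1 inferInstance

lemma toLeftDerived_fromLeftDerived (B : A) (n : ℕ) :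
    toLeftDerived F B n ≫ fromLeftDerived F B n = 0 := by
  refine (Category.assoc _ _ _).trans ?_
  refine (congrArg (_ ≫ ·) ((leftDerivedIso F B n).inv_hom_id_assoc _)).trans ?_
  exact (imageSplicing F B).toHomology_fromHomology n

lemma toLeftDerived_apply (B : A) (n : ℕ) (y : F.obj (op (cosyzygyIter (n + 1) B))) :
    toLeftDerived F B n y = (leftDerivedIso F B n).inv ((imageSplicing F B).toHomology n y) :=
  ConcreteCategory.comp_apply _ _ _

lemma fromLeftDerived_apply (B : A) (n : ℕ) (h : (F.leftDerived n).obj (op B)) :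
    fromLeftDerived F B n h = (imageSplicing F B).fromHomology n ((leftDerivedIso F B n).hom h) :=
  ConcreteCategory.comp_apply _ _ _

lemma toHomology_eq_zero_of_toLeftDerived (B : A) (n : ℕ)
    (y : F.obj (op (cosyzygyIter (n + 1) B))) (hy : toLeftDerived F B n y = 0) :
    (imageSplicing F B).toHomology n y = 0 := by
  rw [toLeftDerived_apply] at hy
  exact (map_eq_zero_iff _
    ((AddCommGrpCat.mono_iff_injective (leftDerivedIso F B n).inv).1 inferInstance)).1 hy

lemma exists_fromLeftDerived_eq (B : A) (n j : ℕ) (hj : (ComplexShape.down ℕ).next n = j)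
    (x : F.obj (op (container B n))) (hx : (imageComplex F B).d n j x = 0) :
    ∃ h, fromLeftDerived F B n h = F.map (intoContainer B n).op x := by
  obtain ⟨h, hh⟩ := (imageSplicing F B).exists_fromHomology_eq n j hj x hx
  refine ⟨(leftDerivedIso F B n).inv h, ?_⟩
  rw [fromLeftDerived_apply, Iso.inv_hom_id_apply]
  exact hh

/-- Any cycle representing the class serves as `x`. -/
lemma exists_map_into_eq_fromLeftDerived (B : A) (n : ℕ) (h : (F.leftDerived n).obj (op B)) :
    ∃ x : F.obj (op (container B n)), F.map (intoContainer B n).op x = fromLeftDerived F B n h := by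
  obtain ⟨z, hz⟩ := (AddCommGrpCat.epi_iff_surjective ((imageComplex F B).homologyπ n)).1
    inferInstance ((leftDerivedIso F B n).hom h)
  refine ⟨(imageComplex F B).iCycles n z, ?_⟩
  rw [fromLeftDerived_apply, ← hz]
  exact (congrArg (fun t => t z) (congrArg ConcreteCategory.hom
    ((imageSplicing F B).π_fromHomology n))).symm

lemma exists_toLeftDerived_eq (B : A) (n : ℕ)
    (hF : ∀ x : F.obj (op (container B n)), F.map (intoContainer B n).op x = 0 →
      ∃ y, F.map (fromContainer B n).op y = x)
    (h : (F.leftDerived n).obj (op B)) (hh : fromLeftDerived F B n h = 0) :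
    ∃ y, toLeftDerived F B n y = h := by
  rw [fromLeftDerived_apply] at hh
  obtain ⟨y, hy⟩ := (imageSplicing F B).exists_toHomology_eq n hF _ hh
  refine ⟨y, (toLeftDerived_apply F B n y).trans ?_⟩
  rw [hy, Iso.hom_inv_id_apply]

lemma stabToDerived_app_toQuotStab (B : A) (n : ℕ) (y : F.obj (op (cosyzygyIter (n + 1) B))) :
    (stabToDerived F n).app (op B) ((toQuotStab F).app (op (cosyzygyIter (n + 1) B)) y) =
      toLeftDerived F B n y := by
  rw [← toQuotStab_stabDesc F (toLeftDerived F B n) (map_into_toLeftDerived F B n)]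
  rfl

/-! ### The fundamental sequence: composites and exactness. -/

lemma stabToDerived_derivedToSatellite (n : ℕ) :
    stabToDerived F n ≫ derivedToSatellite F n = 0 := by
  ext X s
  obtain ⟨y, rfl⟩ := toQuotStab_surjective F (op (cosyzygyIter (n + 1) X.unop)) s
  have h := apply_eq_zero_of_comp (toLeftDerived_fromLeftDerived F X.unop n) y
  change (derivedToSatellite F n).app X ((stabToDerived F n).app (op X.unop) _) = 0
  rw [stabToDerived_app_toQuotStab]
  cases n with
  | zero => rwa [fromLeftDerived_zero_eq] at h
  | succ n =>
    -- In positive degrees the satellite embeds in the value of `F` at the cosyzygy, so vanishing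
    -- can be tested there.
    refine (AddCommGrpCat.mono_iff_injective
      (satelliteOneι F (cosyzygyIter n X.unop))).1 inferInstance ?_
    rw [← toSatellite_ι] at h
    exact h.trans (map_zero _).symm

lemma satelliteOneι_injective (B : A) : Function.Injective (satelliteOneι F B) :=
  (AddCommGrpCat.mono_iff_injective _).1 inferInstance

lemma exists_satelliteOneι_eq (B : A) (y : F.obj (op (cosyzygy B)))
    (hy : F.map (toCosyzygy B).op y = 0) : ∃ s, satelliteOneι F B s = y :=
  (ShortComplex.ab_exact_iff _).1 (ShortComplex.exact_kernel (F.map (toCosyzygy B).op)) y hy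

lemma satelliteOneι_derivedToSatellite (n : ℕ) (B : A) (h : (F.leftDerived (n + 1)).obj (op B)) :
    satelliteOneι F (cosyzygyIter n B) ((derivedToSatellite F (n + 1)).app (op B) h) =
      fromLeftDerived F B (n + 1) h := by
  rw [← toSatellite_ι]
  rfl

lemma satelliteToStab_succ_apply (n : ℕ) (B : A)
    (s : (satelliteOne F).obj (op (cosyzygyIter n B))) :
    (satelliteToStab F (n + 1)).app (op B) s =
      (toQuotStab F).app (op (cosyzygyIter (n + 1) B)) (satelliteOneι F (cosyzygyIter n B) s) :=
  rfl

lemma isExactPair_derivedToSatellite_satelliteToStab (n : ℕ) :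
    IsExactPair (derivedToSatellite F n) (satelliteToStab F n) := by
  cases n with
  | zero =>
    exact ⟨fromLeftDerivedZero_toQuotStab F, ShortComplex.exact_cokernel F.fromLeftDerivedZero⟩
  | succ n =>
    refine isExactPair_of_app _ _ ?_ ?_
    · ext ⟨B⟩ h
      obtain ⟨x, hx⟩ := exists_map_into_eq_fromLeftDerived F B (n + 1) h
      refine (satelliteToStab_succ_apply F n B _).trans ?_
      refine (congrArg _ ((satelliteOneι_derivedToSatellite F n B h).trans hx.symm)).trans ?_
      exact apply_eq_zero_of_comp (map_into_toQuotStab F _) x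
    · rintro ⟨B⟩ s hs
      obtain ⟨x, hx⟩ := exists_map_ι_eq F _ _ hs
      -- The element `s` is `i x` with `e s = 0`, and `d = e ∘ i`; so `x` is a cycle and its class
      -- is the preimage sought.
      have hd : (imageComplex F B).d (n + 1) n x = 0 := by
        rw [(imageSplicing F B).d_eq]
        refine (ConcreteCategory.comp_apply _ _ _).trans ?_
        refine (congrArg ((imageSplicing F B).e n) hx).trans ?_
        exact apply_eq_zero_of_comp (satelliteOneι_map F (cosyzygyIter n B)) s
      obtain ⟨h, hh⟩ := exists_fromLeftDerived_eq F B (n + 1) n (by simp) x hd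
      refine ⟨h, satelliteOneι_injective F _ ?_⟩
      exact (satelliteOneι_derivedToSatellite F n B h).trans (hh.trans hx)

lemma isExactPair_satelliteToStab_stabToDerived (n : ℕ) :
    IsExactPair (satelliteToStab F (n + 1)) (stabToDerived F n) := by
  refine isExactPair_of_app _ _ ?_ ?_
  · ext ⟨B⟩ s
    refine (stabToDerived_app_toQuotStab F B n (satelliteOneι F (cosyzygyIter n B) s)).trans ?_
    refine (toLeftDerived_apply F B n _).trans ((congrArg _ ?_).trans (map_zero _))
    refine (imageSplicing F B).toHomology_eq_zero n _ ?_
    exact apply_eq_zero_of_comp (satelliteOneι_map F (cosyzygyIter n B)) s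
  · rintro ⟨B⟩ s hs
    obtain ⟨y, rfl⟩ := toQuotStab_surjective F (op (cosyzygyIter (n + 1) B)) s
    have hy := toHomology_eq_zero_of_toLeftDerived F B n y
      ((stabToDerived_app_toQuotStab F B n y).symm.trans hs)
    obtain ⟨x, hx⟩ := (imageSplicing F B).exists_e_eq_of_toHomology_eq_zero n y hy
    -- Subtracting `i x` moves `y` into `Ker e`, that is, into the satellite, without changing its
    -- class in `F̲`.
    obtain ⟨s, hs⟩ := exists_satelliteOneι_eq F (cosyzygyIter n B)
      (y - F.map (intoContainer B (n + 1)).op x) 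
      ((map_sub _ _ _).trans (sub_eq_zero.2 hx.symm))
    refine ⟨s, (satelliteToStab_succ_apply F n B s).trans ?_⟩
    refine (congrArg _ hs).trans ((map_sub _ _ _).trans (sub_eq_self.2 ?_))
    exact (apply_eq_zero_of_comp (map_into_toQuotStab F _) x)

instance : Epi (satelliteToStab F 0) := inferInstanceAs (Epi (toQuotStab F))

lemma shortExact_into_from (B : A) (n : ℕ) :
    (ShortComplex.mk _ _ (into_from B n)).ShortExact where
  exact := exact_into_from B n
  mono_f := inferInstanceAs (Mono (intoContainer B n))
  epi_g := inferInstanceAs (Epi (fromContainer B n))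

/-- Half-exactness is used only for the sequences `0 ⟶ ΣⁿB ⟶ Iⁿ ⟶ Σⁿ⁺¹B ⟶ 0`. -/
lemma HalfExact.isExactPair_stabToDerived_derivedToSatellite (hF : HalfExact F) (n : ℕ) :
    IsExactPair (stabToDerived F n) (derivedToSatellite F n) := by
  refine isExactPair_of_app _ _ (stabToDerived_derivedToSatellite F n) ?_
  rintro ⟨B⟩ h hh
  have hh' : fromLeftDerived F B n h = 0 := by
    cases n with
    | zero => rwa [fromLeftDerived_zero_eq]
    | succ n =>
      rw [← satelliteOneι_derivedToSatellite]
      exact (congrArg _ hh).trans (map_zero _)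
  obtain ⟨y, hy⟩ := exists_toLeftDerived_eq F B n
    ((ShortComplex.ab_exact_iff _).1 (hF _ (shortExact_into_from B n))) h hh'
  exact ⟨(toQuotStab F).app (op (cosyzygyIter (n + 1) B)) y,
    (stabToDerived_app_toQuotStab F B n y).trans hy⟩

/-! ### Functors that exchange monomorphisms and epimorphisms. -/

/-- The kernel of `α_F` is the image of `S₁F`, and `S₁F(B)`, the kernel of the monomorphism `F(ΣB) ⟶
F(I)`, is zero. -/
lemma mono_alphaMap (hF : ∀ ⦃X Y : A⦄ (f : X ⟶ Y), Epi f → Mono (F.map f.op)) :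
    Mono (alphaMap F) := by
  obtain ⟨h₀, h⟩ := isExactPair_satelliteToStab_stabToDerived F 0
  refine h.mono_g (NatTrans.ext (funext ?_))
  rintro ⟨B⟩
  have := hF (toCosyzygy B) inferInstance
  have hι : satelliteOneι F B = 0 :=
    (cancel_mono (F.map (toCosyzygy B).op)).1 ((satelliteOneι_map F B).trans zero_comp.symm)
  exact (congrArg (· ≫ (toQuotStab F).app (op (cosyzygy B))) hι).trans zero_comp

lemma isZero_quotStab (hF : ∀ ⦃X Y : A⦄ (f : X ⟶ Y), Mono f → Epi (F.map f.op)) :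
    IsZero (quotStab F) := by
  refine Functor.isZero _ ?_
  rintro ⟨B⟩
  have := hF (Injective.ι B) inferInstance
  refine IsZero.of_epi_eq_zero ((toQuotStab F).app (op B)) ?_
  exact (cancel_epi (F.map (Injective.ι B).op)).1 ((map_into_toQuotStab F B).trans comp_zero.symm)

lemma epi_fromLeftDerivedZero (hF : IsZero (quotStab F)) : Epi F.fromLeftDerivedZero :=
  Preadditive.epi_of_isZero_cokernel _ hF

/-! ### Invertibility of `λ_F` and right-exactness. -/

lemma map_op_comp_apply {B C D : A} (f : B ⟶ C) (g : C ⟶ D) (x : F.obj (op D)) :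
    F.map (f ≫ g).op x = F.map f.op (F.map g.op x) := by
  rw [map_op_comp, ConcreteCategory.comp_apply]

/-- The image of `λ_F` at `B` is contained in that of `F(I) ⟶ F(B)`. -/
lemma map_ι_surjective [Epi F.fromLeftDerivedZero] (B : A) :
    Function.Surjective (F.map (Injective.ι B).op) := by
  intro y
  obtain ⟨h, rfl⟩ := (AddCommGrpCat.epi_iff_surjective (F.fromLeftDerivedZero.app (op B))).1
    inferInstance y
  rw [← fromLeftDerived_zero_eq]
  exact exists_map_into_eq_fromLeftDerived F B 0 h

/-- Every element of `F(I⁰)` is a cycle, and `λ_F` sends the class of `x` to its image in `F(B)`,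
which is zero. Injectivity of `λ_F` makes `x` a boundary, and boundaries factor through `F(ΣB)`. -/
lemma exists_map_toCosyzygy_eq [Mono F.fromLeftDerivedZero] (B : A)
    (x : F.obj (op (Injective.under B))) (hx : F.map (Injective.ι B).op x = 0) :
    ∃ y, F.map (toCosyzygy B).op y = x := by
  have hd : (imageComplex F B).d 0 0 x = 0 := by
    rw [(imageComplex F B).shape _ _ (by simp)]
    rfl
  obtain ⟨z, hz⟩ := exists_iCycles_apply_eq (imageComplex F B) 0 0 (by simp) x hd
  have hπ : (imageComplex F B).homologyπ 0 z = 0 := by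
    have hinj := (AddCommGrpCat.mono_iff_injective
      ((leftDerivedIso F B 0).inv ≫ F.fromLeftDerivedZero.app (op B))).1 inferInstance
    refine hinj (Eq.trans ?_ (map_zero _).symm)
    rw [ConcreteCategory.comp_apply, ← fromLeftDerived_zero_eq]
    refine (fromLeftDerived_apply F B 0 _).trans ?_
    rw [Iso.inv_hom_id_apply]
    refine (congrArg (fun t => t z) (congrArg ConcreteCategory.hom
      ((imageSplicing F B).π_fromHomology 0))).trans ?_
    exact (congrArg (F.map (Injective.ι B).op) hz).trans hx
  obtain ⟨w, hw⟩ := exists_toCycles_apply_eq (imageComplex F B) 0 z hπ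
  refine ⟨F.map (intoContainer B 1).op w, Eq.trans ?_ hz⟩
  rw [← hw, ← ConcreteCategory.comp_apply, ((imageComplex F B).toCycles_i 1 0),
    (imageSplicing F B).d_eq 0]
  rfl

/-- If `λ_F` is an isomorphism, then `F` carries short exact sequences to right exact ones. -/
lemma exact_and_epi_of_isIso [IsIso F.fromLeftDerivedZero] {X Y Z : A} (f : X ⟶ Y) (g : Y ⟶ Z)
    (w : f ≫ g = 0) (hS : (ShortComplex.mk f g w).ShortExact) :
    (∀ y, F.map f.op y = 0 → ∃ z, F.map g.op z = y) ∧ Function.Surjective (F.map f.op) := by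
  have : Mono f := hS.mono_f
  have : Epi g := hS.epi_g
  -- A map that vanishes on `X` factors through `g`, so everything in the image of `F` of such a map
  -- comes from `F(Z)`.
  have desc {W : A} (k : Y ⟶ W) (hk : f ≫ k = 0) (t : F.obj (op W)) :
      ∃ z, F.map g.op z = F.map k.op t := by
    obtain ⟨l, hl⟩ := CokernelCofork.IsColimit.desc' hS.gIsCokernel k hk
    exact ⟨F.map l.op t, by rw [← map_op_comp_apply]; exact congrArg (fun q => F.map q.op t) hl⟩
  let a : Y ⟶ Injective.under X := Injective.factorThru (Injective.ι X) f
  have ha : f ≫ a = Injective.ι X := Injective.comp_factorThru _ _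
  refine ⟨fun y hy => ?_, fun x => ?_⟩
  · obtain ⟨u, rfl⟩ := map_ι_surjective F Y y
    let b : Injective.under X ⟶ Injective.under Y := containerMap f
    have hb : Injective.ι X ≫ b = f ≫ Injective.ι Y := ι_containerMap f
    obtain ⟨v, hv⟩ := exists_map_toCosyzygy_eq F X (F.map b.op u) (by
      rw [← map_op_comp_apply, hb, map_op_comp_apply, hy])
    -- With `y = F(ι_Y) u`, split `ι_Y = a ≫ b + (ι_Y - a ≫ b)`. The second summand vanishes on `X`;
    -- the first contributes `F(a) (F(b) u) = F(a ≫ e_X) v`, where `e_X` is the map `toCosyzygy X`,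
    -- and `a ≫ e_X` vanishes on `X` too. So both contributions come from `F(Z)`.
    obtain ⟨z₁, h₁⟩ := desc (a ≫ toCosyzygy X)
      (by rw [← Category.assoc, ha, ι_toCosyzygy]) v
    obtain ⟨z₂, h₂⟩ := desc (Injective.ι Y - a ≫ b)
      (by rw [Preadditive.comp_sub, ← Category.assoc, ha, hb, sub_self]) u
    refine ⟨z₁ + z₂, ?_⟩
    have hsub : F.map (Injective.ι Y - a ≫ b).op u =
        F.map (Injective.ι Y).op u - F.map (a ≫ b).op u := by
      rw [op_sub, F.map_sub]
      rfl
    rw [map_add, h₁, h₂, hsub, map_op_comp_apply, map_op_comp_apply, hv, add_sub_cancel]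
  · obtain ⟨u, rfl⟩ := map_ι_surjective F X x
    exact ⟨F.map a.op u, by rw [← map_op_comp_apply, ha]⟩

lemma isIso_fromLeftDerivedZero_iff :
    IsIso F.fromLeftDerivedZero ↔ PreservesFiniteColimits F := by
  refine ⟨fun _ => ?_, fun _ => inferInstance⟩
  rw [Functor.preservesFiniteColimits_iff_forall_exact_map_and_epi]
  intro S hS
  -- Passing from `Aᵒᵖ` to `A` reverses the sequence, so `S.g.unop` is the monomorphism and
  -- `S.f.unop` the epimorphism.
  obtain ⟨h₁, h₂⟩ := exact_and_epi_of_isIso F S.g.unop S.f.unop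
    (by rw [← unop_comp, S.zero, unop_zero]) hS.unop
  exact ⟨(ShortComplex.ab_exact_iff _).2 h₁, (AddCommGrpCat.epi_iff_surjective _).2 h₂⟩

end FundamentalSequence

open FundamentalSequence in
/-- The left fundamental sequence of a contravariant additive functor `F` is the sequence
`⋯ ⟶ F̲ ∘ Σⁿ⁺¹ ⟶ LⁿF ⟶ SₙF ⟶ F̲ ∘ Σⁿ ⟶ ⋯ ⟶ F̲ ∘ Σ ⟶ L⁰F ⟶ F ⟶ F̲ ⟶ 0`, with morphisms
`stabToDerived F n`, `derivedToSatellite F n`, `satelliteToStab F n`. -/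
theorem mainTheorem4 {A : Type u} [Category.{v} A] [Abelian A] [EnoughInjectives A]
    (F : Aᵒᵖ ⥤ AddCommGrpCat.{w}) [F.Additive] :
    -- it is a complex, exact at all terms except possibly at `LⁿF`
    ((∀ n, stabToDerived F n ≫ derivedToSatellite F n = 0) ∧
      (∀ n, IsExactPair (derivedToSatellite F n) (satelliteToStab F n)) ∧
      (∀ n, IsExactPair (satelliteToStab F (n + 1)) (stabToDerived F n)) ∧
      Epi (satelliteToStab F 0)) ∧
    -- if `F` is half-exact, it is exact at `LⁿF` as well, that is, everywhere
    (HalfExact F →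
      (∀ n, IsExactPair (stabToDerived F n) (derivedToSatellite F n)) ∧
      (∀ n, IsExactPair (derivedToSatellite F n) (satelliteToStab F n)) ∧
      (∀ n, IsExactPair (satelliteToStab F (n + 1)) (stabToDerived F n)) ∧
      Epi (satelliteToStab F 0)) ∧
    -- if `F` carries epimorphisms to monomorphisms, then `α_F` is monic
    ((∀ ⦃X Y : A⦄ (f : X ⟶ Y), Epi f → Mono (F.map f.op)) → Mono (alphaMap F)) ∧
    -- if `F` carries monomorphisms to epimorphisms, then `F̲ = 0` and `λ_F` is epic
    ((∀ ⦃X Y : A⦄ (f : X ⟶ Y), Mono f → Epi (F.map f.op)) →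
      IsZero (quotStab F) ∧ Epi F.fromLeftDerivedZero) ∧
    -- `λ_F` is an isomorphism if and only if `F` is right-exact
    (IsIso F.fromLeftDerivedZero ↔ PreservesFiniteColimits F) := by
  refine ⟨⟨stabToDerived_derivedToSatellite F, isExactPair_derivedToSatellite_satelliteToStab F,
    isExactPair_satelliteToStab_stabToDerived F, inferInstance⟩, fun hF =>
    ⟨HalfExact.isExactPair_stabToDerived_derivedToSatellite F hF,
      isExactPair_derivedToSatellite_satelliteToStab F,
      isExactPair_satelliteToStab_stabToDerived F, inferInstance⟩, mono_alphaMap F,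
    fun hF => ⟨isZero_quotStab F hF, epi_fromLeftDerivedZero F (isZero_quotStab F hF)⟩,
    isIso_fromLeftDerivedZero_iff F⟩
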